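/- Let $d\ge 1$ and let $M$ be a loopless matroid of rank $d+1$ on a finite set $E$. A flat is nontrivial if it is different from $\emptyset$ and $E$. Let $\mathrm{CH}(M)$ be the Chow ring of $M$ with real coefficients: the quotient of the polynomial ring $\mathbb{R}[\partial_F]$, with one variable for each nontrivial flat $F$, by the ideal generated by the monomials $\prod_{F\in S}\partial_F$ for all sets $S$ of nontrivial flats that are not chains, and by the linear forms $\sum_F \big(\sum_{i\in F} l_i\big)\,\partial_F$ for all $l\in\mathbb{R}^E$ with $\sum_{i\in E} l_i=0$. Denote by $\mathrm{CH}^d(M)$ its degree $d$ part. There is a unique linear map $\deg:\mathrm{CH}^d(M)\to\mathbb{R}$ with $\deg(\partial_{F_1}\cdots\partial_{F_d})=1$ for every maximal chain $F_1<\cdots<F_d$ of nontrivial flats. The mixed volume $\mathrm{Vol}_M\in\mathbb{R}[x_F]$ is the homogeneous polynomial of degree $d$ such that, with $\partial_F=\partial/\partial x_F$, one has $D(\mathrm{Vol}_M)=\deg(D)$ for every homogeneous $D\in\mathbb{R}[\partial_F]$ of degree $d$; equivalently, $\mathrm{Vol}_M=\frac1{d!}\sum \deg(\partial_{F_1}\cdots\partial_{F_d})\,x_{F_1}\cdots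 x_{F_d}$, the sum being over all $d$-tuples of nontrivial flats. Given vectors $v_i\in\mathbb{R}^{d-1}$, $i\in E$, with $\sum_{i\in E} v_i=0$, put $v_F=\sum_{i\in F}v_i$ for $F\subseteq E$. For a maximal chain $\sigma: F_1<\cdots<F_d$ of nontrivial flats let $\hat A_\sigma$ be the $d\times d$ matrix with first row $(x_{F_1},\dots,x_{F_d})$ and, below it, the columns $v_{F_1},\dots,v_{F_d}$. Then $\det\hat A_\sigma=a_1x_{F_1}+\cdots+a_dx_{F_d}$ with $a_j\in\mathbb{R}$; let $c_\sigma=d!\,a_1a_2\cdots a_d$. The family $(v_i)$ is called general if $c_\sigma\neq0$ for all $\sigma$. General families with sum zero exist, and for every such family $$\mathrm{Vol}_M=\sum_\sigma\frac{(\det\hat A_\sigma)^d}{c_\sigma},$$ where the sum runs over all maximal chains $\sigma$ of nontrivial flats. -/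

import Mathlib

/-- The nontrivial flats of a matroid: the flats other than the empty set and the ground set,
ordered by inclusion. -/
abbrev NontrivialFlat {α : Type*} (M : Matroid α) : Type _ :=
  {F : Set α // M.IsFlat F ∧ F ≠ ∅ ∧ F ≠ M.E}

noncomputable instance NontrivialFlat.instFintype {α : Type*} [Fintype α] (M : Matroid α) :
    Fintype (NontrivialFlat M) :=
  Fintype.ofFinite _

/-- Maximal chains `F₁ < ⋯ < F_d` of nontrivial flats, i.e. the maximal cones of the Bergman
fan. -/
abbrev MaximalFlatChain {α : Type*} (M : Matroid α) (d : ℕ) : Type _ :=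
  {F : Fin d → NontrivialFlat M // StrictMono F ∧ IsMaxChain (· ≤ ·) (Set.range F)}

noncomputable instance MaximalFlatChain.instFintype {α : Type*} [Fintype α] (M : Matroid α)
    (d : ℕ) : Fintype (MaximalFlatChain M d) :=
  Fintype.ofFinite _

open Classical in
/-- For a family `v` indexed by the ground set, `v_F = ∑_{i ∈ F} v_i`. -/
noncomputable def sumOverFlat {α V : Type*} [Fintype α] [AddCommMonoid V] (v : α → V)
    (F : Set α) : V :=
  ∑ i with i ∈ F, v i

/-- The ideal of `ℝ[∂_F]` generated by the square-free monomials `∏_{F ∈ S} ∂_F`, where `S` is a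
set of nontrivial flats that is not a chain (the rays `ρ_F`, `F ∈ S`, do not lie in a cone of the
Bergman fan).  The quotient is the Stanley-Reisner ring of the fan. -/
noncomputable def stanleyReisnerIdeal {α : Type*} (M : Matroid α) :
    Ideal (MvPolynomial (NontrivialFlat M) ℝ) :=
  Ideal.span {p | ∃ S : Finset (NontrivialFlat M),
    ¬ IsChain (· ≤ ·) (S : Set (NontrivialFlat M)) ∧ p = ∏ F ∈ S, MvPolynomial.X F}

/-- The ideal of `ℝ[∂_F]` generated by the global linear functions on `ℝ^E / ℝ e_E`.  Such a
function is given by its values `l i` on the `e_i`, with `∑ l i = 0`; restricted to the Bergman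
fan it is the piecewise linear function `∑_F l(e_F) ∂_F`. -/
noncomputable def globalLinearIdeal {α : Type*} [Fintype α] (M : Matroid α) :
    Ideal (MvPolynomial (NontrivialFlat M) ℝ) :=
  Ideal.span {p | ∃ l : α → ℝ, ∑ i, l i = 0 ∧
    p = ∑ F : NontrivialFlat M,
      MvPolynomial.C (sumOverFlat l (F : Set α)) * MvPolynomial.X F}

/-- The Chow ring `CH(M)` (with real coefficients) of a matroid whose ground set is the whole
type `α`. -/
abbrev ChowRing {α : Type*} [Fintype α] (M : Matroid α) : Type _ :=
  MvPolynomial (NontrivialFlat M) ℝ ⧸ (stanleyReisnerIdeal M ⊔ globalLinearIdeal M)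

/-- The degree `d` part `CH^d(M)`. -/
noncomputable def chowPart {α : Type*} [Fintype α] (M : Matroid α) (d : ℕ) :
    Submodule ℝ (ChowRing M) :=
  (MvPolynomial.homogeneousSubmodule (NontrivialFlat M) ℝ d).map
    (Ideal.Quotient.mkₐ ℝ (stanleyReisnerIdeal M ⊔ globalLinearIdeal M)).toLinearMap

theorem chowMonomial_mem {α : Type*} [Fintype α] (M : Matroid α) {d : ℕ}
    (F : Fin d → NontrivialFlat M) :
    (∏ j, Ideal.Quotient.mk (stanleyReisnerIdeal M ⊔ globalLinearIdeal M)
      (MvPolynomial.X (F j)) : ChowRing M) ∈ chowPart M d := by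
  refine ⟨∏ j, MvPolynomial.X (F j), ?_, ?_⟩
  · have := MvPolynomial.IsHomogeneous.prod (R := ℝ) Finset.univ
      (fun j => MvPolynomial.X (F j)) (fun _ => 1)
      (fun j _ => MvPolynomial.isHomogeneous_X ℝ (F j))
    simpa using this
  · simp

/-- The class of `∂_{F₁} ⋯ ∂_{F_d}` in `CH^d(M)` (the flats may repeat and need not form a
chain). -/
noncomputable def chowMonomial {α : Type*} [Fintype α] (M : Matroid α) {d : ℕ}
    (F : Fin d → NontrivialFlat M) : chowPart M d :=
  ⟨∏ j, Ideal.Quotient.mk (stanleyReisnerIdeal M ⊔ globalLinearIdeal M)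
    (MvPolynomial.X (F j)), chowMonomial_mem M F⟩

/-- `φ` takes the value `1` on `∂_σ` for each maximal cone `σ` of the Bergman fan. -/
def IsDegreeMap {α : Type*} [Fintype α] (M : Matroid α) (d : ℕ)
    (φ : chowPart M d →ₗ[ℝ] ℝ) : Prop :=
  ∀ σ : MaximalFlatChain M d, φ (chowMonomial M σ.1) = 1

open Classical in
/-- The canonical degree map `deg : CH^d(M) → ℝ` of a loopless matroid of rank `d + 1`: the linear
map with `deg ∂_σ = 1` for all maximal cones `σ` (zero by convention if there is none). -/
noncomputable def degreeMap {α : Type*} [Fintype α] (M : Matroid α) (d : ℕ) :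
    chowPart M d →ₗ[ℝ] ℝ :=
  if h : ∃ φ, IsDegreeMap M d φ then h.choose else 0

/-- The mixed volume polynomial
`Vol_M = deg ((∑_F x_F ∂_F)^d) / d! = (1 / d!) ∑ deg (∂_{F₁} ⋯ ∂_{F_d}) x_{F₁} ⋯ x_{F_d}`,
the sum being over all `d`-tuples of nontrivial flats.  It is the homogeneous polynomial of
degree `d` for which applying a differential operator of order `d` is the same as taking the
degree of its class in `CH^d(M)`; see `iteratedPDeriv_mixedVolume` and
`mixedVolume_unique`. -/
noncomputable def mixedVolume {α : Type*} [Fintype α] (M : Matroid α) (d : ℕ) :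
    MvPolynomial (NontrivialFlat M) ℝ :=
  MvPolynomial.C ((d.factorial : ℝ)⁻¹) * ∑ F : Fin d → NontrivialFlat M,
    MvPolynomial.C (degreeMap M d (chowMonomial M F)) * ∏ j, MvPolynomial.X (F j)

theorem mixedVolume_isHomogeneous {α : Type*} [Fintype α] (M : Matroid α) (d : ℕ) :
    (mixedVolume M d).IsHomogeneous d := by
  refine MvPolynomial.IsHomogeneous.C_mul (MvPolynomial.IsHomogeneous.sum _ _ _ fun F _ =>
    MvPolynomial.IsHomogeneous.C_mul ?_ _) _
  have := MvPolynomial.IsHomogeneous.prod (R := ℝ) Finset.univ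
    (fun j => MvPolynomial.X (F j)) (fun _ => 1)
    (fun j _ => MvPolynomial.isHomogeneous_X ℝ (F j))
  simpa using this

theorem symmSum_succ {L : Type*} [Fintype L] (d : ℕ) (ψ : Multiset L → ℝ) :
    (∑ f : Fin (d + 1) → L, MvPolynomial.C (ψ (Finset.univ.val.map f)) *
      ∏ j, (MvPolynomial.X (f j) : MvPolynomial L ℝ)) =
    ∑ G : L, MvPolynomial.X G * ∑ f : Fin d → L,
      MvPolynomial.C (ψ (G ::ₘ Finset.univ.val.map f)) * ∏ j, MvPolynomial.X (f j) := by
  rw [← (Fin.consEquiv (fun _ => L)).sum_comp, Fintype.sum_prod_type]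
  refine Finset.sum_congr rfl fun G _ => ?_
  rw [Finset.mul_sum]
  refine Finset.sum_congr rfl fun f _ => ?_
  have h : (Finset.univ : Finset (Fin (d + 1))).val.map (Fin.cons G f : Fin (d + 1) → L) =
      G ::ₘ Finset.univ.val.map f := by
    rw [Fin.univ_succ]
    simp [Function.comp_def]
  simp only [Fin.consEquiv_apply, h, Fin.prod_univ_succ, Fin.cons_zero, Fin.cons_succ]
  ring

theorem pderiv_symmSum {L : Type*} [Fintype L] (G : L) (d : ℕ) (ψ : Multiset L → ℝ) :
    MvPolynomial.pderiv G (∑ f : Fin (d + 1) → L, MvPolynomial.C (ψ (Finset.univ.val.map f)) *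
      ∏ j, (MvPolynomial.X (f j) : MvPolynomial L ℝ)) =
    ((d + 1 : ℕ) : MvPolynomial L ℝ) * ∑ f : Fin d → L,
      MvPolynomial.C (ψ (G ::ₘ Finset.univ.val.map f)) * ∏ j, MvPolynomial.X (f j) := by
  classical
  induction d generalizing ψ with
  | zero =>
    rw [symmSum_succ]
    simp [MvPolynomial.pderiv_X, Pi.single_apply]
  | succ d ih =>
    rw [symmSum_succ, map_sum]
    simp only [Derivation.leibniz, smul_eq_mul]
    rw [Finset.sum_add_distrib]
    have h1 : ∀ H : L, MvPolynomial.X H * MvPolynomial.pderiv G (∑ f : Fin (d + 1) → L,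
        MvPolynomial.C (ψ (H ::ₘ Finset.univ.val.map f)) *
          ∏ j, (MvPolynomial.X (f j) : MvPolynomial L ℝ)) =
        ((d + 1 : ℕ) : MvPolynomial L ℝ) * (MvPolynomial.X H * ∑ f : Fin d → L,
          MvPolynomial.C (ψ (G ::ₘ H ::ₘ Finset.univ.val.map f)) *
            ∏ j, MvPolynomial.X (f j)) := by
      intro H
      rw [ih (fun s => ψ (H ::ₘ s))]
      simp only [Multiset.cons_swap H G]
      ring
    simp only [h1]
    rw [← Finset.mul_sum, ← symmSum_succ d (fun s => ψ (G ::ₘ s))]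
    simp only [MvPolynomial.pderiv_X, Pi.single_apply, mul_ite, mul_one, mul_zero]
    push_cast
    simp only [Finset.sum_ite_eq', Finset.mem_univ, if_true]
    ring

theorem iteratedPDeriv_symmSum {L : Type*} [Fintype L] (d : ℕ) (ψ : Multiset L → ℝ)
    (F : Fin d → L) :
    (List.ofFn F).foldl (fun p G => MvPolynomial.pderiv G p)
      (∑ f : Fin d → L, MvPolynomial.C (ψ (Finset.univ.val.map f)) *
        ∏ j, (MvPolynomial.X (f j) : MvPolynomial L ℝ)) =
    MvPolynomial.C (d.factorial * ψ (Finset.univ.val.map F)) := by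
  induction d generalizing ψ with
  | zero => simp [Subsingleton.elim (default : Fin 0 → L) F]
  | succ d ih =>
    have h : (Finset.univ : Finset (Fin (d + 1))).val.map F =
        F 0 ::ₘ Finset.univ.val.map (fun j => F (Fin.succ j)) := by
      rw [Fin.univ_succ]
      simp [Function.comp_def]
    rw [List.ofFn_succ, List.foldl_cons, pderiv_symmSum]
    have := ih (fun s => ((d + 1 : ℕ) : ℝ) * ψ (F 0 ::ₘ s)) (fun j => F (Fin.succ j))
    simp only [map_mul, mul_assoc, ← Finset.mul_sum, map_natCast] at this
    rw [this, h, Nat.factorial_succ]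
    simp only [map_mul, map_natCast, Nat.cast_mul]
    ring

/-- Applying `∂_{F₁} ⋯ ∂_{F_d}` to the mixed volume polynomial gives the degree of the class of
this monomial in `CH^d(M)`. -/
theorem iteratedPDeriv_mixedVolume {α : Type*} [Fintype α] (M : Matroid α) {d : ℕ}
    (F : Fin d → NontrivialFlat M) :
    (List.ofFn F).foldl (fun p G => MvPolynomial.pderiv G p) (mixedVolume M d) =
      MvPolynomial.C (degreeMap M d (chowMonomial M F)) := by
  classical
  let ψ : Multiset (NontrivialFlat M) → ℝ := fun s =>
    if h : ((s.map fun G => Ideal.Quotient.mk (stanleyReisnerIdeal M ⊔ globalLinearIdeal M)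
      (MvPolynomial.X G)).prod : ChowRing M) ∈ chowPart M d then degreeMap M d ⟨_, h⟩ else 0
  have hψ : ∀ f : Fin d → NontrivialFlat M,
      ψ (Finset.univ.val.map f) = degreeMap M d (chowMonomial M f) := by
    intro f
    have e : ((Finset.univ.val.map f).map fun G =>
        Ideal.Quotient.mk (stanleyReisnerIdeal M ⊔ globalLinearIdeal M)
        (MvPolynomial.X G)).prod = (chowMonomial M f : ChowRing M) := by
      rw [Multiset.map_map]; rfl
    have hm := (chowMonomial M f).2
    rw [← e] at hm
    simp only [ψ]
    rw [dif_pos hm]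
    exact congrArg _ (Subtype.ext e)
  have key := iteratedPDeriv_symmSum d (fun s => ((d.factorial : ℝ)⁻¹) * ψ s) F
  simp only [hψ, map_mul, mul_assoc, ← Finset.mul_sum] at key
  unfold mixedVolume
  rw [key]
  simp only [← map_mul]
  congr 1
  have : (d.factorial : ℝ) ≠ 0 := by positivity
  field_simp

/-- A homogeneous polynomial of degree `d` is determined by its derivatives of order `d`. -/
theorem mixedVolume_unique {L : Type*} [Fintype L] {d : ℕ} {V W : MvPolynomial L ℝ}
    (hV : V.IsHomogeneous d) (hW : W.IsHomogeneous d)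
    (h : ∀ F : Fin d → L, (List.ofFn F).foldl (fun p G => MvPolynomial.pderiv G p) V =
      (List.ofFn F).foldl (fun p G => MvPolynomial.pderiv G p) W) : V = W := by
  induction d generalizing V W with
  | zero => simpa using h Fin.elim0
  | succ d ih =>
    have hp : ∀ G, MvPolynomial.pderiv G V = MvPolynomial.pderiv G W := fun G =>
      ih (by simpa using hV.pderiv) (by simpa using hW.pderiv) fun F => by
        simpa [List.ofFn_succ] using h (Fin.cons G F)
    have eV := hV.sum_X_mul_pderiv
    have eW := hW.sum_X_mul_pderiv
    simp only [hp] at eV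
    have := eV.symm.trans eW
    exact smul_right_injective _ (Nat.succ_ne_zero d) this

/-- The matrix `Â_σ` of the chain `σ = (F₁ < ⋯ < F_{k+1})`, where `k = d - 1`: the first row
is `(x_{F₁}, …, x_{F_d})` and below it are the columns `v_{F₁}, …, v_{F_d}`. -/
noncomputable def augmentedMatrix {α : Type*} [Fintype α] (M : Matroid α) {k : ℕ}
    (v : α → Fin k → ℝ) (F : Fin (k + 1) → NontrivialFlat M) :
    Matrix (Fin (k + 1)) (Fin (k + 1)) (MvPolynomial (NontrivialFlat M) ℝ) :=
  Matrix.of (Fin.cons (fun j => MvPolynomial.X (F j))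
    (fun i j => MvPolynomial.C (sumOverFlat v (F j : Set α) i)))

/-- The constant `c_σ = d! a₁ ⋯ a_d`, where `det Â_σ = a₁ x_{F₁} + ⋯ + a_d x_{F_d}` and
`d = k + 1`. -/
noncomputable def chainConstant {α : Type*} [Fintype α] (M : Matroid α) {k : ℕ}
    (v : α → Fin k → ℝ) (F : Fin (k + 1) → NontrivialFlat M) : ℝ :=
  ((k + 1).factorial : ℝ) *
    ∏ j, (augmentedMatrix M v F).det.coeff (Finsupp.single (F j) 1)

/-- The vectors `v_i ∈ ℝ^k` sum to zero and are general: all constants `c_σ` are nonzero. -/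
def IsGeneralFamily {α : Type*} [Fintype α] (M : Matroid α) {k : ℕ}
    (v : α → Fin k → ℝ) : Prop :=
  ∑ i, v i = 0 ∧ ∀ σ : MaximalFlatChain M (k + 1), chainConstant M v σ.1 ≠ 0

/-!
# The mixed volume polynomial of a matroid

Write `d = k + 1`, and for a maximal chain `σ` of nontrivial flats let `a_σ(F)` be the coefficient
of `x_F` in `det Â_σ`; it is zero for `F` outside `σ`. A differential operator `p(∂)` of order `d`
maps `∑_σ (det Â_σ)^d / c_σ` to `∑_σ p(a_σ) / ∏_{F ∈ σ} a_σ(F)`. The theorem says that this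
functional (`degreeFunctional`) is the degree map, so that the formula for the mixed volume is the
multinomial expansion of `(∑_F a_σ(F) x_F)^d`.

The functional takes the value `1` on every maximal chain and kills monomials that are not
supported on a chain. It also kills the multiples of a linear form `∑_F (y · v_F) ∂_F`, for each
`σ` separately, since `y · v_F` as first row makes the determinant vanish
(`sum_dotProduct_mul_detCoeff`). These special linear forms are enough to rewrite any
monomial on a chain in terms of square-free ones: the vectors `v_F` of at most `k` flats of a chain
are independent, so a repeated variable can be exchanged for variables outside the support
(`eq_zero_of_squarefree_of_linear`). In degree `d` the square-free monomials on chains are the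
maximal chains, which gives the uniqueness of the degree map (`eq_zero_of_chowMonomial_eq_zero`).
In degree `d - 1` it reduces the vanishing of the functional on multiples of an arbitrary global
linear form to multiples by square-free monomials on chains of length `d - 1`. There it is the
balancing condition of the Bergman fan: if `A < B` are the neighbours of the gap in the chain, the
flats strictly between them partition `B \ A` (`sum_sumOverFlat_sub`), and the determinants with
the columns of `A` or `B` in the gap vanish (`sum_update_signedMinor_eq_zero`). So the
functional descends to the Chow ring.

General families exist (`exists_isGeneralFamily`) because each of the finitely many minors that have
to be nonzero is a nonzero polynomial in the coordinates of the family.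
-/

/-! ### Ranks of flats and maximal chains -/

section Flats

variable {α : Type*} {M : Matroid α}

/-- The rank of a set in a matroid as a natural number, with junk value `0` for infinite rank. -/
noncomputable def flatRank (M : Matroid α) (X : Set α) : ℕ := (M.eRk X).toNat

theorem flatRank_empty (M : Matroid α) : flatRank M ∅ = 0 := by simp [flatRank]

theorem flatRank_ground {n : ℕ} (hrank : M.eRank = (n : ℕ∞)) : flatRank M M.E = n := by
  simp [flatRank, M.eRk_ground, hrank]

theorem closure_insert_subset {F G : Set α} (hG : M.IsFlat G) (h : F ⊆ G) {e : α} (he : e ∈ G) :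
    M.closure (insert e F) ⊆ G := by
  rw [← hG.closure]
  exact M.closure_subset_closure (Set.insert_subset he h)

theorem subset_closure_insert {F : Set α} (hF : M.IsFlat F) {e : α} (he : e ∈ M.E) :
    insert e F ⊆ M.closure (insert e F) :=
  M.subset_closure _ (Set.insert_subset he hF.subset_ground)

theorem isFlat_empty [M.Loopless] : M.IsFlat ∅ := by
  rw [Matroid.isFlat_iff_closure_eq]
  exact M.loops_eq_empty

/-- The chain `F₁ < ⋯ < F_d` extended by `F₀ = ∅` and `F_n = E` for `n > d`. -/
def chainExt {d : ℕ} (σ : Fin d → NontrivialFlat M) (n : ℕ) : Set α :=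
  if n = 0 then ∅ else if h : n - 1 < d then σ ⟨n - 1, h⟩ else Set.univ

@[simp] theorem chainExt_zero {d : ℕ} (σ : Fin d → NontrivialFlat M) : chainExt σ 0 = ∅ := rfl

@[simp] theorem chainExt_succ {d : ℕ} (σ : Fin d → NontrivialFlat M) (i : Fin d) :
    chainExt σ (i + 1) = σ i := by simp [chainExt]

theorem chainExt_of_lt {d : ℕ} (σ : Fin d → NontrivialFlat M) {n : ℕ} (h : d < n) :
    chainExt σ n = Set.univ := by
  have h1 : n ≠ 0 := by omega
  have h2 : ¬ n - 1 < d := by omega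
  simp [chainExt, h1, h2]

theorem chainExt_cases {d : ℕ} (n : ℕ) : n = 0 ∨ d < n ∨ ∃ i : Fin d, n = i + 1 := by
  rcases Nat.eq_zero_or_pos n with h | h
  · exact Or.inl h
  · by_cases h' : d < n
    · exact Or.inr (Or.inl h')
    · exact Or.inr (Or.inr ⟨⟨n - 1, by omega⟩, by simp; omega⟩)

theorem chainExt_isFlat [M.Loopless] (hE : M.E = Set.univ) {d : ℕ} (σ : Fin d → NontrivialFlat M)
    (n : ℕ) : M.IsFlat (chainExt σ n) := by
  rcases chainExt_cases (d := d) n with rfl | h | ⟨i, rfl⟩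
  · exact isFlat_empty
  · rw [chainExt_of_lt σ h, ← hE]; exact M.ground_isFlat
  · rw [chainExt_succ]; exact (σ i).2.1

theorem chainExt_mono {d : ℕ} {σ : Fin d → NontrivialFlat M} (hσ : StrictMono σ) :
    Monotone (chainExt σ) := by
  intro m n hmn
  rcases chainExt_cases (d := d) m with rfl | h | ⟨i, rfl⟩
  · exact Set.empty_subset _
  · rw [chainExt_of_lt σ h, chainExt_of_lt σ (h.trans_le hmn)]
  · rcases chainExt_cases (d := d) n with rfl | h | ⟨j, rfl⟩
    · omega
    · rw [chainExt_of_lt σ h]; exact Set.subset_univ _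
    · rw [chainExt_succ, chainExt_succ]
      exact hσ.monotone (Fin.le_def.2 (by omega))

theorem strictMono_update_iff {d : ℕ} {σ : Fin d → NontrivialFlat M}
    (hσ : StrictMono σ) (hE : M.E = Set.univ) (j : Fin d) (F : NontrivialFlat M) :
    StrictMono (Function.update σ j F) ↔
      chainExt σ j ⊂ (F : Set α) ∧ (F : Set α) ⊂ chainExt σ (j + 2) := by
  constructor
  · intro h
    constructor
    · rcases chainExt_cases (d := d) j with h0 | h0 | ⟨i, hi⟩
      · rw [h0]; exact Set.empty_ssubset.2 (Set.nonempty_iff_ne_empty.2 F.2.2.1)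
      · exact absurd h0 (by omega)
      · have hij : i < j := Fin.lt_def.2 (by omega)
        have := h hij
        rw [Function.update_self, Function.update_of_ne hij.ne] at this
        rw [hi, chainExt_succ]; exact this
    · rcases chainExt_cases (d := d) (j + 2) with h0 | h0 | ⟨i, hi⟩
      · omega
      · rw [chainExt_of_lt σ h0, Set.ssubset_univ_iff, ← hE]; exact F.2.2.2
      · have hij : j < i := Fin.lt_def.2 (by omega)
        have := h hij
        rw [Function.update_self, Function.update_of_ne hij.ne'] at this
        rw [hi, chainExt_succ]; exact this
  · rintro ⟨h1, h2⟩ a b hab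
    rcases eq_or_ne a j with rfl | ha
    · rw [Function.update_self, Function.update_of_ne hab.ne']
      refine h2.trans_le ?_
      rw [← chainExt_succ]
      exact chainExt_mono hσ (by have := Fin.lt_def.1 hab; omega)
    · rcases eq_or_ne b j with rfl | hb
      · rw [Function.update_self, Function.update_of_ne ha]
        refine lt_of_le_of_lt (b := chainExt σ b) ?_ h1
        change (σ a : Set α) ≤ _
        rw [← chainExt_succ]
        exact chainExt_mono hσ (by have := Fin.lt_def.1 hab; omega)
      · rw [Function.update_of_ne ha, Function.update_of_ne hb]
        exact hσ hab

variable [Fintype α]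

theorem coe_flatRank (M : Matroid α) (X : Set α) : (flatRank M X : ℕ∞) = M.eRk X :=
  ENat.natCast_toNat ((M.eRk_le_encard X).trans_lt (Set.toFinite X).encard_lt_top).ne

theorem flatRank_mono (M : Matroid α) {X Y : Set α} (h : X ⊆ Y) : flatRank M X ≤ flatRank M Y := by
  have := M.eRk_mono h
  rw [← coe_flatRank, ← coe_flatRank] at this
  exact_mod_cast this

theorem flatRank_lt {F G : Set α} (hF : M.IsFlat F) (hG : M.IsFlat G) (h : F ⊂ G) :
    flatRank M F < flatRank M G := by
  refine lt_of_le_of_ne (flatRank_mono M h.subset) fun e => h.ne ?_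
  have hfin : M.IsRkFinite F := by
    rw [← Matroid.eRk_ne_top_iff, ← coe_flatRank]; simp
  have := hfin.closure_eq_closure_of_subset_of_eRk_ge_eRk h.subset
    (by rw [← coe_flatRank, ← coe_flatRank, e])
  rwa [hF.closure, hG.closure] at this

theorem eq_of_flatRank_le {F G : Set α} (hF : M.IsFlat F) (hG : M.IsFlat G) (h : F ⊆ G)
    (hr : flatRank M G ≤ flatRank M F) : F = G := by
  by_contra hne
  exact (flatRank_lt hF hG (lt_of_le_of_ne h hne)).not_ge hr

theorem flatRank_closure_insert {F : Set α} (hF : M.IsFlat F) {e : α} (he : e ∈ M.E)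
    (heF : e ∉ F) : flatRank M (M.closure (insert e F)) = flatRank M F + 1 := by
  have := M.eRk_insert_eq_add_one (e := e) (X := F) ⟨he, by rwa [hF.closure]⟩
  rw [← Matroid.eRk_closure_eq, ← coe_flatRank, ← coe_flatRank] at this
  exact_mod_cast this

theorem NontrivialFlat.flatRank_pos [M.Loopless] (F : NontrivialFlat M) :
    0 < flatRank M (F : Set α) := by
  have := flatRank_lt isFlat_empty F.2.1 (Set.empty_ssubset.2 (Set.nonempty_iff_ne_empty.2 F.2.2.1))
  omega

theorem NontrivialFlat.flatRank_lt_ground (F : NontrivialFlat M) :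
    flatRank M (F : Set α) < flatRank M M.E :=
  flatRank_lt F.2.1 M.ground_isFlat (lt_of_le_of_ne F.2.1.subset_ground F.2.2.2)

/-- A maximal chain of nontrivial flats meets every intermediate rank: between two consecutive
members of a chain with a gap in the ranks, a cover of the smaller one could be inserted. -/
theorem IsMaxChain.exists_flatRank_eq [M.Loopless] {C : Set (NontrivialFlat M)}
    (hC : IsMaxChain (· ≤ ·) C) {i : ℕ} (hi : 0 < i) (hi' : i < flatRank M M.E) :
    ∃ F ∈ C, flatRank M (F : Set α) = i := by
  by_contra! hno
  -- adjoining `∅` and `E` ensures that there are members of rank below and above `i`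
  set C' : Set (Set α) := insert ∅ (insert M.E ((fun F : NontrivialFlat M => (F : Set α)) '' C))
    with hC'
  have hflat : ∀ A ∈ C', M.IsFlat A := by
    rintro A (rfl | rfl | ⟨F, _, rfl⟩)
    exacts [isFlat_empty, M.ground_isFlat, F.2.1]
  have hchain : ∀ A ∈ C', ∀ B ∈ C', A ⊆ B ∨ B ⊆ A := by
    rintro A (rfl | rfl | ⟨F, hF, rfl⟩) B (rfl | rfl | ⟨G, hG, rfl⟩)
    any_goals simp
    · exact Or.inr G.2.1.subset_ground
    · exact Or.inl F.2.1.subset_ground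
    · exact hC.isChain.total hF hG
  have hne : ∀ A ∈ C', flatRank M A ≠ i := by
    rintro A (rfl | rfl | ⟨F, hF, rfl⟩)
    · rw [flatRank_empty]; omega
    · omega
    · exact hno F hF
  have hle : ∀ A ∈ C', ∀ B ∈ C', flatRank M A ≤ flatRank M B → A ⊆ B := by
    intro A hA B hB h
    rcases hchain A hA B hB with h' | h'
    · exact h'
    · exact (eq_of_flatRank_le (hflat B hB) (hflat A hA) h' h).symm.subset
  obtain ⟨A, ⟨hA, hAi⟩, hAmax⟩ := Set.exists_max_image {A ∈ C' | flatRank M A < i} (flatRank M)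
    (Set.toFinite _) ⟨∅, by simp [hC'], by simpa [flatRank_empty] using hi⟩
  obtain ⟨B, ⟨hB, hBi⟩, hBmin⟩ := Set.exists_min_image {A ∈ C' | i < flatRank M A} (flatRank M)
    (Set.toFinite _) ⟨M.E, by simp [hC'], hi'⟩
  have hAB : A ⊆ B := hle A hA B hB (by omega)
  obtain ⟨e, heB, heA⟩ : ∃ e ∈ B, e ∉ A := by
    by_contra! h
    have := flatRank_mono M (show B ⊆ A from h)
    omega
  have heE := (hflat B hB).subset_ground heB
  have hH := flatRank_closure_insert (hflat A hA) heE heA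
  have hAH : A ⊆ M.closure (insert e A) :=
    (Set.subset_insert _ _).trans (subset_closure_insert (hflat A hA) heE)
  have hHB := closure_insert_subset (hflat B hB) hAB heB
  let H : NontrivialFlat M := ⟨M.closure (insert e A), M.isFlat_closure _, by
    intro h; rw [h, flatRank_empty] at hH; omega, by
    intro h; rw [h] at hH; omega⟩
  have hHC : H ∈ C := by
    by_contra hHC
    refine hHC (hC.2 (t := insert H C) (hC.isChain.insert fun G hG _ => ?_)
      (Set.subset_insert _ _) ▸ Set.mem_insert _ _)
    have hG' : (G : Set α) ∈ C' := by
      simp only [hC', Set.mem_insert_iff, Set.mem_image]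
      exact Or.inr (Or.inr ⟨G, hG, rfl⟩)
    rcases lt_or_gt_of_ne (hne _ hG') with h | h
    · right
      exact (hle _ hG' A hA (hAmax _ ⟨hG', h⟩)).trans hAH
    · left
      exact hHB.trans (hle B hB _ hG' (hBmin _ ⟨hG', h⟩))
  have hHC' : M.closure (insert e A) ∈ C' := by
    simp only [hC', Set.mem_insert_iff, Set.mem_image]
    exact Or.inr (Or.inr ⟨H, hHC, rfl⟩)
  rcases (show flatRank M A + 1 ≤ i by omega).lt_or_eq with h | h
  · have := hAmax _ ⟨hHC', by omega⟩
    omega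
  · exact hne _ hHC' (by omega)

/-- Every chain of nontrivial flats extends to a chain `F₁ < ⋯ < F_d` with `d + 1` the rank. -/
theorem exists_maximalFlatChain [M.Loopless] {d : ℕ} (hrank : M.eRank = ((d + 1 : ℕ) : ℕ∞))
    {S : Set (NontrivialFlat M)} (hS : IsChain (· ≤ ·) S) :
    ∃ σ : MaximalFlatChain M d, S ⊆ Set.range σ.1 := by
  obtain ⟨C, hC, hSC⟩ := hS.exists_maxChain
  have hE := flatRank_ground hrank
  have hex : ∀ i : Fin d, ∃ F ∈ C, flatRank M (F : Set α) = i + 1 := fun i =>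
    hC.exists_flatRank_eq (Nat.succ_pos _) (by omega)
  choose σ hσC hσ using hex
  have hrange : Set.range σ = C := by
    refine Set.Subset.antisymm (Set.range_subset_iff.2 hσC) fun G hG => ?_
    have h1 := G.flatRank_pos
    have h2 := G.flatRank_lt_ground
    refine ⟨⟨flatRank M (G : Set α) - 1, by omega⟩, Subtype.ext ?_⟩
    have h3 := hσ ⟨flatRank M (G : Set α) - 1, by omega⟩
    simp only at h3
    rcases hC.isChain.total (hσC ⟨flatRank M (G : Set α) - 1, by omega⟩) hG with h | h
    · exact eq_of_flatRank_le (σ _).2.1 G.2.1 h (by omega)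
    · exact (eq_of_flatRank_le G.2.1 (σ _).2.1 h (by omega)).symm
  refine ⟨⟨σ, fun i j hij => ?_, hrange ▸ hC⟩, hrange ▸ hSC⟩
  rcases hC.isChain.total (hσC i) (hσC j) with h | h
  · refine lt_of_le_of_ne h fun e => ?_
    have := hσ i
    rw [e, hσ j] at this
    simp only [Fin.lt_def] at hij
    omega
  · have := flatRank_mono M (show (σ j : Set α) ⊆ σ i from h)
    rw [hσ, hσ] at this
    simp only [Fin.lt_def] at hij
    omega

theorem flatRank_strictMono_apply [M.Loopless] {d : ℕ} (hrank : M.eRank = ((d + 1 : ℕ) : ℕ∞))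
    {σ : Fin d → NontrivialFlat M} (hσ : StrictMono σ) (i : Fin d) :
    flatRank M (σ i : Set α) = i + 1 := by
  have hE := flatRank_ground hrank
  let g : Fin d → Fin d := fun i => ⟨flatRank M (σ i : Set α) - 1, by
    have h1 := (σ i).flatRank_pos
    have h2 := (σ i).flatRank_lt_ground
    omega⟩
  have hg : StrictMono g := fun i j hij => by
    have h1 := (σ i).flatRank_pos
    have h2 := flatRank_lt (σ i).2.1 (σ j).2.1 (hσ hij)
    simp only [g, Fin.lt_def]
    omega
  have h := le_antisymm (hg.apply_le (x := i)) hg.le_apply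
  have h1 := (σ i).flatRank_pos
  have h2 := congrArg Fin.val h
  simp only [g] at h2
  omega

theorem isMaxChain_range_of_strictMono [M.Loopless] {d : ℕ}
    (hrank : M.eRank = ((d + 1 : ℕ) : ℕ∞)) {σ : Fin d → NontrivialFlat M} (hσ : StrictMono σ) :
    IsMaxChain (· ≤ ·) (Set.range σ) := by
  have hchain : IsChain (· ≤ ·) (Set.range σ) := hσ.monotone.isChain_range
  obtain ⟨τ, hτ⟩ := exists_maximalFlatChain hrank hchain
  have h : Set.range σ = Set.range τ.1 := by
    refine Set.eq_of_subset_of_ncard_le hτ ?_ (Set.toFinite _)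
    rw [← Set.image_univ, ← Set.image_univ, Set.ncard_image_of_injective _ hσ.injective,
      Set.ncard_image_of_injective _ τ.2.1.injective]
  exact h ▸ τ.2.2

theorem flatRank_chainExt [M.Loopless] (hE : M.E = Set.univ) {d : ℕ}
    (hrank : M.eRank = ((d + 1 : ℕ) : ℕ∞)) {σ : Fin d → NontrivialFlat M} (hσ : StrictMono σ)
    {n : ℕ} (hn : n ≤ d + 1) : flatRank M (chainExt σ n) = n := by
  rcases chainExt_cases (d := d) n with rfl | h | ⟨i, rfl⟩
  · exact flatRank_empty M
  · rw [chainExt_of_lt σ h, ← hE, flatRank_ground hrank]; omega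
  · rw [chainExt_succ, flatRank_strictMono_apply hrank hσ]

open Classical in
/-- Balancing of the Bergman fan: the flats `F` which complete a chain with one member removed,
leaving a gap `A < B`, have differences `F \ A` which partition `B \ A`. -/
theorem sum_sumOverFlat_sub [M.Loopless] (hE : M.E = Set.univ) {d : ℕ}
    (hrank : M.eRank = ((d + 1 : ℕ) : ℕ∞)) {σ : Fin d → NontrivialFlat M} (hσ : StrictMono σ)
    (j : Fin d) {V : Type*} [AddCommGroup V] (w : α → V) :
    ∑ F : NontrivialFlat M with StrictMono (Function.update σ j F),
        (sumOverFlat w (F : Set α) - sumOverFlat w (chainExt σ j)) =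
      sumOverFlat w (chainExt σ (j + 2)) - sumOverFlat w (chainExt σ j) := by
  set A := chainExt σ j
  set B := chainExt σ (j + 2)
  have hA : M.IsFlat A := chainExt_isFlat hE σ _
  have hB : M.IsFlat B := chainExt_isFlat hE σ _
  have hAB : A ⊆ B := chainExt_mono hσ (by omega)
  have hrA : flatRank M A = j := flatRank_chainExt hE hrank hσ (by omega)
  have hrB : flatRank M B = j + 2 := flatRank_chainExt hE hrank hσ (by omega)
  have hdiff : ∀ X : Set α, A ⊆ X → X ⊆ B → sumOverFlat w X - sumOverFlat w A =
      ∑ i with i ∈ B \ A, if i ∈ X then w i else 0 := by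
    intro X hAX hXB
    unfold sumOverFlat
    rw [sub_eq_iff_eq_add, ← Finset.sum_filter, Finset.filter_filter,
      ← Finset.sum_union]
    · refine Finset.sum_congr ?_ fun _ _ => rfl
      ext i
      simp only [Finset.mem_filter, Finset.mem_univ, true_and, Finset.mem_union, Set.mem_sdiff]
      have := @hAX i
      have := @hXB i
      tauto
    · refine Finset.disjoint_left.2 fun i hi hi' => ?_
      simp only [Finset.mem_filter, Finset.mem_univ, true_and, Set.mem_sdiff] at hi hi'
      exact hi.1.2 hi'
  have hmem : ∀ F : NontrivialFlat M, StrictMono (Function.update σ j F) ↔ A ⊂ F.1 ∧ F.1 ⊂ B :=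
    strictMono_update_iff hσ hE j
  rw [hdiff B hAB subset_rfl, Finset.sum_congr rfl fun F hF => hdiff F.1
    ((hmem F).1 (Finset.mem_filter.1 hF).2).1.subset
    ((hmem F).1 (Finset.mem_filter.1 hF).2).2.subset, Finset.sum_comm]
  refine Finset.sum_congr rfl fun i hi => ?_
  obtain ⟨hiB, hiA⟩ := (Finset.mem_filter.1 hi).2
  have hiE := hB.subset_ground hiB
  have hG := flatRank_closure_insert hA hiE hiA
  have hsub := subset_closure_insert hA hiE
  let G : NontrivialFlat M := ⟨M.closure (insert i A), M.isFlat_closure _, by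
    intro h; rw [h, flatRank_empty] at hG; omega, by
    intro h; rw [h] at hG
    have := flatRank_mono M hB.subset_ground
    omega⟩
  have hGmem : StrictMono (Function.update σ j G) := by
    rw [hmem]
    refine ⟨lt_of_le_of_ne ((Set.subset_insert _ _).trans hsub) fun h => ?_,
      lt_of_le_of_ne (closure_insert_subset hB hAB hiB) fun h => ?_⟩
    · rw [h] at hiA; exact hiA (hsub (Set.mem_insert _ _))
    · simp only [G] at h; rw [h] at hG; omega
  rw [Finset.sum_eq_single G, if_pos (hsub (Set.mem_insert _ _)), if_pos hiB]
  · intro F hF hFG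
    refine if_neg fun hiF => hFG (Subtype.ext ?_)
    have hF := (hmem F).1 (Finset.mem_filter.1 hF).2
    have := flatRank_lt F.2.1 hB hF.2
    exact (eq_of_flatRank_le (M.isFlat_closure _) F.2.1
      (closure_insert_subset F.2.1 hF.1.subset hiF) (by omega)).symm
  · intro h
    exact absurd (Finset.mem_filter.2 ⟨Finset.mem_univ G, hGmem⟩) h

end Flats

/-! ### The determinant of the augmented matrix -/

section Determinant

variable {α : Type*} [Fintype α] {M : Matroid α} {k : ℕ}

/-- The signed minor of the augmented matrix of `F` at the `j`-th entry of its first row. -/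
noncomputable def signedMinor (M : Matroid α) {R : Type*} [CommRing R] (v : α → Fin k → R)
    (F : Fin (k + 1) → NontrivialFlat M) (j : Fin (k + 1)) : R :=
  (-1) ^ (j : ℕ) *
    (Matrix.of fun a b : Fin k => sumOverFlat v (F (j.succAbove b) : Set α) a).det

theorem sum_mul_signedMinor (v : α → Fin k → ℝ) (F : Fin (k + 1) → NontrivialFlat M)
    (c : Fin (k + 1) → ℝ) :
    ∑ j, c j * signedMinor M v F j = (Matrix.of (Fin.cons c
      (fun i j => sumOverFlat v (F j : Set α) i)) : Matrix (Fin (k + 1)) (Fin (k + 1)) ℝ).det := by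
  rw [Matrix.det_succ_row_zero]
  refine Finset.sum_congr rfl fun j _ => ?_
  rw [signedMinor]
  simp only [Matrix.of_apply, Fin.cons_zero]
  rw [mul_left_comm, ← mul_assoc]
  rfl

theorem det_augmentedMatrix (v : α → Fin k → ℝ) (F : Fin (k + 1) → NontrivialFlat M) :
    (augmentedMatrix M v F).det =
      ∑ j, MvPolynomial.C (signedMinor M v F j) * MvPolynomial.X (F j) := by
  rw [Matrix.det_succ_row_zero]
  refine Finset.sum_congr rfl fun j _ => ?_
  have h : (augmentedMatrix M v F).submatrix Fin.succ j.succAbove = MvPolynomial.C.mapMatrix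
      (Matrix.of fun a b : Fin k => sumOverFlat v (F (j.succAbove b) : Set α) a) := by
    ext1 a b
    simp [augmentedMatrix]
  rw [h, ← RingHom.map_det, signedMinor]
  simp only [augmentedMatrix, Matrix.of_apply, Fin.cons_zero, map_mul, map_pow, map_neg, map_one]
  ring

/-- The coefficient `a_G` of `x_G` in `det Â_σ`, as a function on all nontrivial flats. -/
noncomputable def detCoeff (M : Matroid α) (v : α → Fin k → ℝ)
    (F : Fin (k + 1) → NontrivialFlat M) (G : NontrivialFlat M) : ℝ :=
  (augmentedMatrix M v F).det.coeff (Finsupp.single G 1)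

open Classical in
theorem detCoeff_eq_sum (v : α → Fin k → ℝ) (F : Fin (k + 1) → NontrivialFlat M)
    (G : NontrivialFlat M) :
    detCoeff M v F G = ∑ j, if F j = G then signedMinor M v F j else 0 := by
  rw [detCoeff, det_augmentedMatrix, MvPolynomial.coeff_sum]
  refine Finset.sum_congr rfl fun j _ => ?_
  rw [MvPolynomial.coeff_C_mul, MvPolynomial.coeff_X]
  simp [Finsupp.single_left_inj]

theorem detCoeff_apply {v : α → Fin k → ℝ} {F : Fin (k + 1) → NontrivialFlat M}
    (hF : Function.Injective F) (j : Fin (k + 1)) :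
    detCoeff M v F (F j) = signedMinor M v F j := by
  classical
  simp [detCoeff_eq_sum, hF.eq_iff]

theorem detCoeff_eq_zero {v : α → Fin k → ℝ} {F : Fin (k + 1) → NontrivialFlat M}
    {G : NontrivialFlat M} (hG : G ∉ Set.range F) : detCoeff M v F G = 0 := by
  classical
  rw [detCoeff_eq_sum]
  exact Finset.sum_eq_zero fun j _ => if_neg fun h => hG ⟨j, h⟩

theorem sum_mul_detCoeff (v : α → Fin k → ℝ) (F : Fin (k + 1) → NontrivialFlat M)
    (c : NontrivialFlat M → ℝ) :
    ∑ G, c G * detCoeff M v F G = ∑ j, c (F j) * signedMinor M v F j := by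
  classical
  simp only [detCoeff_eq_sum, Finset.mul_sum]
  rw [Finset.sum_comm]
  simp

theorem det_augmentedMatrix_eq_sum_detCoeff (v : α → Fin k → ℝ)
    (F : Fin (k + 1) → NontrivialFlat M) :
    (augmentedMatrix M v F).det =
      ∑ G, MvPolynomial.C (detCoeff M v F G) * MvPolynomial.X G := by
  classical
  rw [det_augmentedMatrix]
  simp only [detCoeff_eq_sum, map_sum, Finset.sum_mul]
  rw [Finset.sum_comm]
  refine Finset.sum_congr rfl fun j _ => ?_
  rw [Finset.sum_eq_single (F j)]
  · simp
  · intro G _ hG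
    simp [hG.symm]
  · simp

/-- A linear function which factors through `v` annihilates `det Â_σ`: the first row becomes a
combination of the others. -/
theorem sum_dotProduct_mul_detCoeff (v : α → Fin k → ℝ) (F : Fin (k + 1) → NontrivialFlat M)
    (y : Fin k → ℝ) :
    ∑ G : NontrivialFlat M, y ⬝ᵥ sumOverFlat v (G : Set α) * detCoeff M v F G = 0 := by
  rw [sum_mul_detCoeff v F fun G => y ⬝ᵥ sumOverFlat v (G : Set α), sum_mul_signedMinor,
    ← Matrix.exists_vecMul_eq_zero_iff]
  refine ⟨Fin.cons (-1) y, fun h => ?_, ?_⟩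
  · have := congrFun h 0
    simp at this
  · ext j
    simp [Matrix.vecMul, dotProduct, Fin.sum_univ_succ]

theorem exists_dual_of_signedMinor_ne_zero {v : α → Fin k → ℝ} {F : Fin (k + 1) → NontrivialFlat M}
    {j : Fin (k + 1)} (h : signedMinor M v F j ≠ 0) (i : Fin k) :
    ∃ y : Fin k → ℝ, ∀ b, y ⬝ᵥ sumOverFlat v (F (j.succAbove b) : Set α) =
      if b = i then 1 else 0 := by
  set N : Matrix (Fin k) (Fin k) ℝ :=
    Matrix.of fun a b : Fin k => sumOverFlat v (F (j.succAbove b) : Set α) a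
  have hN : IsUnit N.det := isUnit_iff_ne_zero.2 (right_ne_zero_of_mul h)
  refine ⟨Matrix.vecMul (Pi.single i 1) N⁻¹, fun b => ?_⟩
  have := Matrix.vecMul_vecMul (Pi.single i (1 : ℝ)) N⁻¹ N
  rw [Matrix.nonsing_inv_mul _ hN, Matrix.vecMul_one] at this
  have := congrFun this b
  rw [Pi.single_apply] at this
  exact this

theorem sumOverFlat_apply {ι : Type*} {R : Type*} [AddCommMonoid R] (v : α → ι → R) (X : Set α)
    (a : ι) :
    sumOverFlat v X a = sumOverFlat (fun i => v i a) X := by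
  simp [sumOverFlat]

theorem map_sumOverFlat {V W G : Type*} [AddCommMonoid V] [AddCommMonoid W] [FunLike G V W]
    [AddMonoidHomClass G V W] (g : G) (v : α → V) (X : Set α) :
    g (sumOverFlat v X) = sumOverFlat (fun i => g (v i)) X := by
  simp [sumOverFlat]

theorem sumOverFlat_univ {V : Type*} [AddCommMonoid V] (v : α → V) :
    sumOverFlat v Set.univ = ∑ i, v i := by
  simp [sumOverFlat]

theorem sumOverFlat_empty {V : Type*} [AddCommMonoid V] (v : α → V) :
    sumOverFlat v (∅ : Set α) = 0 := by
  simp [sumOverFlat]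

theorem dotProduct_sumOverFlat (y : Fin k → ℝ) (v : α → Fin k → ℝ) (X : Set α) :
    y ⬝ᵥ sumOverFlat v X = sumOverFlat (fun i => y ⬝ᵥ v i) X := by
  classical
  simp only [sumOverFlat, dotProduct_sum]

open Classical in
/-- Exchanging one flat of a maximal chain in all possible ways, the values of a global linear
function on `det Â` add up to zero. -/
theorem sum_update_signedMinor_eq_zero [M.Loopless] (hE : M.E = Set.univ)
    (hrank : M.eRank = ((k + 1 + 1 : ℕ) : ℕ∞)) {v : α → Fin k → ℝ} (hv : ∑ i, v i = 0)
    {l : α → ℝ} (hl : ∑ i, l i = 0) {σ : Fin (k + 1) → NontrivialFlat M} (hσ : StrictMono σ)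
    (j : Fin (k + 1)) :
    ∑ F : NontrivialFlat M with StrictMono (Function.update σ j F),
      ∑ i, sumOverFlat l (Function.update σ j F i : Set α) *
        signedMinor M v (Function.update σ j F) i = 0 := by
  set w : α → Fin (k + 1) → ℝ := fun i => Fin.cons (l i) (v i) with hw
  have hwX : ∀ X : Set α, sumOverFlat w X = Fin.cons (sumOverFlat l X) (sumOverFlat v X) := by
    intro X
    ext a
    rw [sumOverFlat_apply]
    refine Fin.cases ?_ (fun a => ?_) a
    · simp [hw]
    · simp [hw, sumOverFlat_apply v]
  have hwsum : ∑ i, w i = 0 := by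
    rw [← sumOverFlat_univ, hwX, sumOverFlat_univ, sumOverFlat_univ, hl, hv]
    ext a
    refine Fin.cases ?_ (fun a => ?_) a <;> simp
  set D : (Fin (k + 1) → ℝ) →ₗ[ℝ] ℝ :=
    (Matrix.detRowAlternating (n := Fin (k + 1)) (R := ℝ)).toMultilinearMap.toLinearMap
      (fun a => sumOverFlat w (σ a : Set α)) j with hD
  have hDapp : ∀ x, D x = Matrix.det
      (Function.update (fun a => sumOverFlat w (σ a : Set α)) j x) := fun x => rfl
  -- `D` kills the columns of the two flats around the gap, also if one of these is `∅` or `E`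
  have hD0 : ∀ n : ℕ, n ≠ j + 1 → D (sumOverFlat w (chainExt σ n)) = 0 := by
    intro n hn
    rcases chainExt_cases (d := k + 1) n with rfl | h | ⟨i, rfl⟩
    · rw [chainExt_zero, sumOverFlat_empty, map_zero]
    · rw [chainExt_of_lt σ h, sumOverFlat_univ, hwsum, map_zero]
    · have hij : i ≠ j := fun e => hn (by rw [e])
      rw [chainExt_succ, hDapp]
      refine Matrix.det_zero_of_row_eq hij ?_
      rw [Function.update_self, Function.update_of_ne hij]
  have hterm : ∀ F : NontrivialFlat M, ∑ i, sumOverFlat l (Function.update σ j F i : Set α) *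
        signedMinor M v (Function.update σ j F) i = D (sumOverFlat w (F : Set α)) := by
    intro F
    rw [sum_mul_signedMinor v _ fun i => sumOverFlat l (Function.update σ j F i : Set α), hDapp,
      ← Matrix.det_transpose]
    congr 1
    ext a b
    rcases eq_or_ne a j with rfl | ha
    · rw [Function.update_self, hwX]
      refine Fin.cases ?_ (fun b => ?_) b <;> simp
    · rw [Function.update_of_ne ha, hwX]
      refine Fin.cases ?_ (fun b => ?_) b <;> simp [ha]
  have := congrArg D (sum_sumOverFlat_sub hE hrank hσ j w)
  rw [map_sum, map_sub, hD0 j (by omega), hD0 (j + 2) (by omega), sub_zero] at this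
  rw [← this]
  refine Finset.sum_congr rfl fun F _ => ?_
  rw [hterm, map_sub, hD0 j (by omega), sub_zero]

end Determinant

/-! ### Existence of general families -/

section General

variable {α : Type*} [Fintype α] {M : Matroid α} {k : ℕ}

theorem chainConstant_ne_zero_iff {v : α → Fin k → ℝ} {F : Fin (k + 1) → NontrivialFlat M}
    (hF : Function.Injective F) :
    chainConstant M v F ≠ 0 ↔ ∀ j, signedMinor M v F j ≠ 0 := by
  have : ((k + 1).factorial : ℝ) ≠ 0 := by positivity
  change ((k + 1).factorial : ℝ) * ∏ j, detCoeff M v F (F j) ≠ 0 ↔ _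
  simp [this, Finset.prod_ne_zero_iff, detCoeff_apply hF]

/-- For a single minor a family with sum zero can be chosen such that the minor is that of the
identity matrix: put the increments along the chain on elements `e_i ∈ F_{i+1} \ F_i`. -/
theorem exists_signedMinor_ne_zero [M.Loopless] (hE : M.E = Set.univ)
    (hrank : M.eRank = ((k + 1 + 1 : ℕ) : ℕ∞)) {σ : Fin (k + 1) → NontrivialFlat M}
    (hσ : StrictMono σ) (j : Fin (k + 1)) :
    ∃ v : α → Fin k → ℝ, ∑ i, v i = 0 ∧ signedMinor M v σ j ≠ 0 := by
  classical
  have hex : ∀ i : Fin (k + 2), ∃ e, e ∈ chainExt σ (i + 1) ∧ e ∉ chainExt σ i := by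
    intro i
    by_contra! h
    have := flatRank_mono M (show chainExt σ (i + 1) ⊆ chainExt σ i from h)
    rw [flatRank_chainExt hE hrank hσ (by omega), flatRank_chainExt hE hrank hσ (by omega)] at this
    omega
  choose e he he' using hex
  let t : ℕ → Fin k → ℝ := fun n b => if n = (j.succAbove b : ℕ) + 1 then 1 else 0
  let v : α → Fin k → ℝ := ∑ i : Fin (k + 2), Pi.single (e i) (t (i + 1) - t i)
  have ht0 : t 0 = 0 := by ext b; simp [t]
  have htop : t (k + 2) = 0 := by
    ext b
    have := (j.succAbove b).isLt
    simp only [t, Pi.zero_apply, ite_eq_right_iff]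
    omega
  have hmem : ∀ (i : Fin (k + 2)) (n : ℕ), e i ∈ chainExt σ n ↔ (i : ℕ) < n := by
    intro i n
    refine ⟨fun h => ?_, fun h => chainExt_mono hσ h (he i)⟩
    by_contra hn
    exact he' i (chainExt_mono hσ (not_lt.1 hn) h)
  have hv : ∀ n ≤ k + 2, sumOverFlat v (chainExt σ n) = t n := by
    intro n hn
    have h1 : sumOverFlat v (chainExt σ n) =
        ∑ i : Fin (k + 2), if (i : ℕ) < n then t (i + 1) - t i else 0 := by
      simp only [sumOverFlat, v, Finset.sum_apply]
      rw [Finset.sum_comm]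
      refine Finset.sum_congr rfl fun i _ => ?_
      simp only [← hmem]
      simp [Pi.single_apply, Finset.sum_ite_eq']
    rw [h1, Fin.sum_univ_eq_sum_range (fun i => if i < n then t (i + 1) - t i else 0),
      ← Finset.sum_filter]
    have h2 : (Finset.range (k + 2)).filter (· < n) = Finset.range n := by
      ext i; simp; omega
    rw [h2, Finset.sum_range_sub, ht0, sub_zero]
  refine ⟨v, ?_, ?_⟩
  · rw [← sumOverFlat_univ, ← chainExt_of_lt σ (Nat.lt_succ_self _), hv _ le_rfl, htop]
  · have h : (Matrix.of fun a b : Fin k => sumOverFlat v (σ (j.succAbove b) : Set α) a) = 1 := by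
      ext a b
      rw [Matrix.of_apply, ← chainExt_succ, hv _ (by have := (j.succAbove b).isLt; omega),
        Matrix.one_apply]
      simp only [t, add_left_inj, Fin.val_inj, Fin.succAbove_right_inj, eq_comm]
    rw [signedMinor, h, Matrix.det_one, mul_one]
    exact pow_ne_zero _ (by norm_num)

theorem map_signedMinor {R S : Type*} [CommRing R] [CommRing S] (g : R →+* S)
    (v : α → Fin k → R) (F : Fin (k + 1) → NontrivialFlat M) (j : Fin (k + 1)) :
    g (signedMinor M v F j) = signedMinor M (fun i a => g (v i a)) F j := by
  rw [signedMinor, signedMinor, map_mul, RingHom.map_det]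
  simp only [map_pow, map_neg, map_one]
  congr 2
  ext a b
  simp [sumOverFlat_apply, map_sumOverFlat]

/-- General families exist, since the product of all the minors is a nonzero polynomial in the
coordinates of a family, shifted by its mean so that its sum is zero. -/
theorem exists_isGeneralFamily [M.Loopless] (hE : M.E = Set.univ)
    (hrank : M.eRank = ((k + 1 + 1 : ℕ) : ℕ∞)) : ∃ v : α → Fin k → ℝ, IsGeneralFamily M v := by
  let center : (α × Fin k → ℝ) → α → Fin k → ℝ := fun u i a =>
    u (i, a) - (Fintype.card α : ℝ)⁻¹ * ∑ i', u (i', a)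
  let U : α → Fin k → MvPolynomial (α × Fin k) ℝ := fun i a =>
    MvPolynomial.X (i, a) - MvPolynomial.C (Fintype.card α : ℝ)⁻¹ * ∑ i', MvPolynomial.X (i', a)
  have heval : ∀ u (F : Fin (k + 1) → NontrivialFlat M) j,
      MvPolynomial.eval u (signedMinor M U F j) = signedMinor M (center u) F j := by
    intro u F j
    rw [map_signedMinor]
    simp [U, center]
  have hP : ∏ σ : MaximalFlatChain M (k + 1), ∏ j, signedMinor M U σ.1 j ≠ 0 := by
    simp only [Finset.prod_ne_zero_iff]
    intro σ _ j _ h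
    obtain ⟨v, hv, hne⟩ := exists_signedMinor_ne_zero hE hrank σ.2.1 j
    have hc : center (fun p => v p.1 p.2) = v := by
      ext i a
      have := congrFun hv a
      simp only [Finset.sum_apply, Pi.zero_apply] at this
      simp [center, this]
    have := heval (fun p => v p.1 p.2) σ.1 j
    rw [h, map_zero, hc] at this
    exact hne this.symm
  obtain ⟨u, hu⟩ : ∃ u, MvPolynomial.eval u
      (∏ σ : MaximalFlatChain M (k + 1), ∏ j, signedMinor M U σ.1 j) ≠ 0 := by
    by_contra! h
    exact hP (MvPolynomial.funext fun u => by rw [h, map_zero])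
  refine ⟨center u, ?_, fun σ => ?_⟩
  · ext a
    rcases isEmpty_or_nonempty α with h | h
    · simp
    · have : (Fintype.card α : ℝ) ≠ 0 := by simp
      simp [center, this]
  · rw [chainConstant_ne_zero_iff σ.2.1.injective]
    simp only [map_prod, Finset.prod_ne_zero_iff] at hu
    intro j
    rw [← heval]
    exact hu σ (Finset.mem_univ _) j (Finset.mem_univ _)

end General

/-! ### Reduction to square-free monomials -/

/-- A function on the monomials of degree `e ≤ k + 1` in variables indexed by an ordered set `L`
vanishes if it vanishes on monomials not supported on a chain, on square-free monomials, and on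
the multiples of the linear forms `∑ (y · u_G) x_G`.  Here the vectors `u_G ∈ ℝᵏ` along a chain
with at most `k` members are supposed independent, so that a repeated variable `x_F` can be
replaced, modulo a linear form, by variables outside the support, which enlarges the support. -/
theorem eq_zero_of_squarefree_of_linear {L : Type*} [Fintype L] [PartialOrder L] {k : ℕ}
    (u : L → Fin k → ℝ)
    (hdual : ∀ S : Finset L, IsChain (· ≤ ·) (S : Set L) → S.card ≤ k → ∀ F ∈ S,
      ∃ y : Fin k → ℝ, y ⬝ᵥ u F = 1 ∧ ∀ G ∈ S, G ≠ F → y ⬝ᵥ u G = 0)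
    {e : ℕ} (he : e ≤ k + 1) (ψ : (L →₀ ℕ) → ℝ)
    (hnonchain : ∀ m : L →₀ ℕ, ¬ IsChain (· ≤ ·) (m.support : Set L) → ψ m = 0)
    (hlinear : ∀ (y : Fin k → ℝ) (m : L →₀ ℕ), m.degree + 1 = e →
      ∑ G, y ⬝ᵥ u G * ψ (m + Finsupp.single G 1) = 0)
    (hsquarefree : ∀ m : L →₀ ℕ, m.degree = e → IsChain (· ≤ ·) (m.support : Set L) →
      (∀ F, m F ≤ 1) → ψ m = 0)
    (m : L →₀ ℕ) (hm : m.degree = e) : ψ m = 0 := by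
  classical
  induction hn : e - m.support.card using Nat.strong_induction_on generalizing m with
  | _ n ih =>
  by_cases hchain : IsChain (· ≤ ·) (m.support : Set L)
  swap
  · exact hnonchain m hchain
  by_cases hsq : ∀ F, m F ≤ 1
  · exact hsquarefree m hm hchain hsq
  push Not at hsq
  obtain ⟨F, hF⟩ := hsq
  have hFs : F ∈ m.support := Finsupp.mem_support_iff.2 (by omega)
  have hcard : m.support.card < e := by
    rw [← hm, Finsupp.degree_apply, Finset.card_eq_sum_ones]
    exact Finset.sum_lt_sum (fun i hi => Nat.one_le_iff_ne_zero.2 (Finsupp.mem_support_iff.1 hi))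
      ⟨F, hFs, hF⟩
  obtain ⟨y, hyF, hy⟩ := hdual m.support hchain (by omega) F hFs
  obtain ⟨m', rfl⟩ : ∃ m', m = m' + Finsupp.single F 1 :=
    ⟨m - Finsupp.single F 1, (tsub_add_cancel_of_le (Finsupp.single_le_iff.2 (by omega))).symm⟩
  have hsupp : (m' + Finsupp.single F 1).support = m'.support := by
    ext G
    simp only [Finsupp.mem_support_iff, Finsupp.add_apply, Finsupp.single_apply] at hF ⊢
    split_ifs with h
    · subst h; simp at hF ⊢; omega
    · simp
  have hdeg : m'.degree + 1 = e := by simpa using hm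
  have hsum := hlinear y m' hdeg
  rw [Finset.sum_eq_single F, hyF, one_mul] at hsum
  · exact hsum
  · intro G _ hGF
    by_cases hG : G ∈ (m' + Finsupp.single F 1).support
    · rw [hy G hG hGF, zero_mul]
    · have hsupp' : (m' + Finsupp.single G 1).support = insert G m'.support := by
        ext H
        simp only [Finsupp.mem_support_iff, Finsupp.add_apply, Finsupp.single_apply,
          Finset.mem_insert]
        split_ifs with h
        · simp [h]
        · simp [Ne.symm h]
      rw [ih _ ?_ (m' + Finsupp.single G 1) (by simpa using hdeg) rfl, mul_zero]
      rw [hsupp', Finset.card_insert_of_notMem (hsupp ▸ hG), ← hn, hsupp]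
      rw [hsupp] at hcard
      omega
  · simp

/-! ### The degree functional -/

section Degree

variable {α : Type*} [Fintype α] {M : Matroid α} {k : ℕ}

theorem exists_dual_of_chain [M.Loopless] (hrank : M.eRank = ((k + 1 + 1 : ℕ) : ℕ∞))
    {v : α → Fin k → ℝ} (hv : IsGeneralFamily M v) (S : Finset (NontrivialFlat M))
    (hS : IsChain (· ≤ ·) (S : Set (NontrivialFlat M))) (hcard : S.card ≤ k)
    (F : NontrivialFlat M) (hF : F ∈ S) :
    ∃ y : Fin k → ℝ, y ⬝ᵥ sumOverFlat v (F : Set α) = 1 ∧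
      ∀ G ∈ S, G ≠ F → y ⬝ᵥ sumOverFlat v (G : Set α) = 0 := by
  classical
  obtain ⟨σ, hσ⟩ := exists_maximalFlatChain hrank hS
  have hmin := (chainConstant_ne_zero_iff σ.2.1.injective).1 (hv.2 σ)
  obtain ⟨j, hj⟩ : ∃ j, σ.1 j ∉ S := by
    by_contra! h
    have := Finset.card_le_card_of_injOn (s := Finset.univ) (t := S) σ.1 (fun j _ => h j)
      σ.2.1.injective.injOn
    simp at this
    omega
  have hidx : ∀ G ∈ S, ∃ b, σ.1 (j.succAbove b) = G := by
    intro G hG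
    obtain ⟨i, rfl⟩ := hσ hG
    obtain ⟨b, rfl⟩ := Fin.exists_succAbove_eq (x := i) (y := j) (by rintro rfl; exact hj hG)
    exact ⟨b, rfl⟩
  obtain ⟨i, hi⟩ := hidx F hF
  obtain ⟨y, hy⟩ := exists_dual_of_signedMinor_ne_zero (hmin j) i
  refine ⟨y, by rw [← hi, hy, if_pos rfl], fun G hG hGF => ?_⟩
  obtain ⟨b, hb⟩ := hidx G hG
  rw [← hb, hy, if_neg]
  rintro rfl
  exact hGF (hb.symm.trans hi)

/-- The value of a monomial in the `∂_F`, regarded as a differential operator, on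
`∑_σ (det Â_σ)^d / c_σ` if the degree of the monomial is `d = k + 1`.  In other degrees this is
a formal expression. -/
noncomputable def monomialDegree (M : Matroid α) (v : α → Fin k → ℝ) (m : NontrivialFlat M →₀ ℕ) :
    ℝ :=
  ∑ σ : MaximalFlatChain M (k + 1),
    (∏ j, signedMinor M v σ.1 j)⁻¹ * m.prod fun F n => detCoeff M v σ.1 F ^ n

theorem monomialDegree_add_single (v : α → Fin k → ℝ) (m : NontrivialFlat M →₀ ℕ)
    (G : NontrivialFlat M) :
    monomialDegree M v (m + Finsupp.single G 1) = ∑ σ : MaximalFlatChain M (k + 1),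
      (∏ j, signedMinor M v σ.1 j)⁻¹ * ((m.prod fun F n => detCoeff M v σ.1 F ^ n) *
        detCoeff M v σ.1 G) := by
  classical
  refine Finset.sum_congr rfl fun σ _ => ?_
  rw [Finsupp.prod_add_index' (by simp) (fun _ _ _ => pow_add _ _ _),
    Finsupp.prod_single_index (by simp), pow_one]

theorem prod_detCoeff_eq_zero {v : α → Fin k → ℝ} {F : Fin (k + 1) → NontrivialFlat M}
    {m : NontrivialFlat M →₀ ℕ} (hm : ¬ (m.support : Set (NontrivialFlat M)) ⊆ Set.range F) :
    (m.prod fun G n => detCoeff M v F G ^ n) = 0 := by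
  obtain ⟨G, hG, hGF⟩ := Set.not_subset.1 hm
  refine Finset.prod_eq_zero (i := G) hG ?_
  dsimp only
  rw [detCoeff_eq_zero hGF, zero_pow (Finsupp.mem_support_iff.1 hG)]

theorem prod_detCoeff_eq_zero_of_not_isChain {v : α → Fin k → ℝ} {m : NontrivialFlat M →₀ ℕ}
    (hm : ¬ IsChain (· ≤ ·) (m.support : Set (NontrivialFlat M)))
    (σ : MaximalFlatChain M (k + 1)) :
    (m.prod fun G n => detCoeff M v σ.1 G ^ n) = 0 :=
  prod_detCoeff_eq_zero fun h => hm (σ.2.2.isChain.mono h)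

theorem monomialDegree_of_not_isChain {v : α → Fin k → ℝ} {m : NontrivialFlat M →₀ ℕ}
    (hm : ¬ IsChain (· ≤ ·) (m.support : Set (NontrivialFlat M))) :
    monomialDegree M v m = 0 :=
  Finset.sum_eq_zero fun σ _ => by rw [prod_detCoeff_eq_zero_of_not_isChain hm, mul_zero]

theorem prod_pow_eq_prod_support {ι : Type*} {m : ι →₀ ℕ} (hm : ∀ i, m i ≤ 1) (a : ι → ℝ) :
    (m.prod fun i n => a i ^ n) = ∏ i ∈ m.support, a i := by
  refine Finset.prod_congr rfl fun i hi => ?_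
  have := Finsupp.mem_support_iff.1 hi
  have := hm i
  simp only [show m i = 1 by omega, pow_one]

theorem card_support_of_le_one {ι : Type*} {m : ι →₀ ℕ} (hm : ∀ i, m i ≤ 1) :
    m.support.card = m.degree := by
  rw [Finsupp.degree_apply, Finset.card_eq_sum_ones]
  refine Finset.sum_congr rfl fun i hi => ?_
  have := Finsupp.mem_support_iff.1 hi
  have := hm i
  omega

theorem signedMinor_update (v : α → Fin k → ℝ) (σ : Fin (k + 1) → NontrivialFlat M)
    (j : Fin (k + 1)) (F : NontrivialFlat M) :
    signedMinor M v (Function.update σ j F) j = signedMinor M v σ j := by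
  simp [signedMinor]

theorem prod_detCoeff_image [DecidableEq (NontrivialFlat M)] {v : α → Fin k → ℝ}
    {σ : Fin (k + 1) → NontrivialFlat M} (hσ : Function.Injective σ)
    (hv : ∀ j, signedMinor M v σ j ≠ 0) (j : Fin (k + 1)) :
    (∏ j, signedMinor M v σ j)⁻¹ * ∏ G ∈ (Finset.univ.erase j).image σ, detCoeff M v σ G =
      (signedMinor M v σ j)⁻¹ := by
  rw [Finset.prod_image hσ.injOn]
  simp only [detCoeff_apply hσ]
  have h := Finset.mul_prod_erase Finset.univ (signedMinor M v σ) (Finset.mem_univ j)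
  have h0 : ∏ i ∈ Finset.univ.erase j, signedMinor M v σ i ≠ 0 :=
    Finset.prod_ne_zero_iff.2 fun i _ => hv i
  rw [← h, mul_inv, mul_assoc, inv_mul_cancel₀ h0, mul_one]

/-- The balancing condition at a chain of `d - 1` flats: the chains which complete it have the same
minor at the new flat, so the sum is one of determinants. -/
theorem sum_mul_monomialDegree_of_squarefree [M.Loopless] (hE : M.E = Set.univ)
    (hrank : M.eRank = ((k + 1 + 1 : ℕ) : ℕ∞)) {v : α → Fin k → ℝ} (hv : IsGeneralFamily M v)
    {l : α → ℝ} (hl : ∑ i, l i = 0) {m : NontrivialFlat M →₀ ℕ} (hdeg : m.degree = k)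
    (hm : IsChain (· ≤ ·) (m.support : Set (NontrivialFlat M))) (hsq : ∀ F, m F ≤ 1) :
    ∑ G : NontrivialFlat M, sumOverFlat l (G : Set α) *
      monomialDegree M v (m + Finsupp.single G 1) = 0 := by
  classical
  obtain ⟨σ, hσ⟩ := exists_maximalFlatChain hrank hm
  have hmin : ∀ τ : MaximalFlatChain M (k + 1), ∀ j, signedMinor M v τ.1 j ≠ 0 := fun τ =>
    (chainConstant_ne_zero_iff τ.2.1.injective).1 (hv.2 τ)
  have hcard : m.support.card = k := (card_support_of_le_one hsq).trans hdeg
  obtain ⟨j, hj⟩ : ∃ j, σ.1 j ∉ m.support := by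
    by_contra! h
    have := Finset.card_le_card_of_injOn (s := Finset.univ) (t := m.support) σ.1 (fun j _ => h j)
      σ.2.1.injective.injOn
    simp at this
    omega
  have himage : m.support = (Finset.univ.erase j).image σ.1 := by
    refine Finset.eq_of_subset_of_card_le (fun G hG => ?_) ?_
    · obtain ⟨i, rfl⟩ := hσ hG
      refine Finset.mem_image_of_mem _ (Finset.mem_erase.2 ⟨?_, Finset.mem_univ _⟩)
      rintro rfl
      exact hj hG
    · rw [Finset.card_image_of_injective _ σ.2.1.injective, hcard]
      simp
  let b : (Fin (k + 1) → NontrivialFlat M) → ℝ := fun F =>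
    ∑ i, sumOverFlat l (F i : Set α) * signedMinor M v F i
  have hb : ∀ F, ∑ G : NontrivialFlat M, sumOverFlat l (G : Set α) * detCoeff M v F G = b F :=
    fun F => sum_mul_detCoeff v F fun G => sumOverFlat l (G : Set α)
  have hswap : ∑ G : NontrivialFlat M, sumOverFlat l (G : Set α) *
      monomialDegree M v (m + Finsupp.single G 1) = ∑ τ : MaximalFlatChain M (k + 1),
        (∏ j, signedMinor M v τ.1 j)⁻¹ * (∏ G ∈ m.support, detCoeff M v τ.1 G) * b τ.1 := by
    simp only [monomialDegree_add_single, prod_pow_eq_prod_support hsq, Finset.mul_sum, ← hb]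
    rw [Finset.sum_comm]
    refine Finset.sum_congr rfl fun τ _ => Finset.sum_congr rfl fun G _ => ?_
    ring
  -- only the chains that agree with `σ` away from `j` contribute
  have hagree : ∀ τ : MaximalFlatChain M (k + 1), ¬ (∀ i, i ≠ j → τ.1 i = σ.1 i) →
      ∏ G ∈ m.support, detCoeff M v τ.1 G = 0 := by
    intro τ hτ
    push Not at hτ
    obtain ⟨i, hij, hne⟩ := hτ
    have hi : σ.1 i ∈ m.support := by
      rw [himage]
      exact Finset.mem_image_of_mem _ (Finset.mem_erase.2 ⟨hij, Finset.mem_univ _⟩)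
    refine Finset.prod_eq_zero hi (detCoeff_eq_zero ?_)
    rintro ⟨i', hi'⟩
    have h1 := flatRank_strictMono_apply hrank τ.2.1 i'
    rw [hi', flatRank_strictMono_apply hrank σ.2.1 i] at h1
    have : i = i' := Fin.ext (by omega)
    exact hne (this ▸ hi')
  rw [hswap, ← Finset.sum_filter_of_ne (p := fun τ => ∀ i, i ≠ j → τ.1 i = σ.1 i)]
  swap
  · intro τ _ hτ
    by_contra h
    rw [hagree τ h] at hτ
    simp at hτ
  have key := sum_update_signedMinor_eq_zero hE hrank hv.1 hl σ.2.1 j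
  change ∑ F : NontrivialFlat M with StrictMono (Function.update σ.1 j F),
    b (Function.update σ.1 j F) = 0 at key
  rw [← mul_zero (signedMinor M v σ.1 j)⁻¹, ← key, Finset.mul_sum]
  have hupd : ∀ τ : MaximalFlatChain M (k + 1), (∀ i, i ≠ j → τ.1 i = σ.1 i) →
      Function.update σ.1 j (τ.1 j) = τ.1 := by
    intro τ hτ
    ext1 i
    rcases eq_or_ne i j with rfl | hij
    · rw [Function.update_self]
    · rw [Function.update_of_ne hij, hτ i hij]
  refine Finset.sum_bij' (fun τ _ => τ.1 j)
    (fun F hF => ⟨Function.update σ.1 j F, (Finset.mem_filter.1 hF).2,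
      isMaxChain_range_of_strictMono hrank (Finset.mem_filter.1 hF).2⟩) ?_ ?_ ?_ ?_ ?_
  · intro τ hτ
    refine Finset.mem_filter.2 ⟨Finset.mem_univ _, ?_⟩
    rw [hupd τ (Finset.mem_filter.1 hτ).2]
    exact τ.2.1
  · intro F hF
    refine Finset.mem_filter.2 ⟨Finset.mem_univ _, fun i hij => ?_⟩
    exact Function.update_of_ne hij _ _
  · intro τ hτ
    exact Subtype.ext (hupd τ (Finset.mem_filter.1 hτ).2)
  · intro F hF
    simp
  · intro τ hτ
    have hτ := (Finset.mem_filter.1 hτ).2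
    have h1 : m.support = (Finset.univ.erase j).image τ.1 := by
      rw [himage]
      refine Finset.image_congr fun i hi => (hτ i ?_).symm
      simpa using hi
    have h2 : signedMinor M v τ.1 j = signedMinor M v σ.1 j := by
      rw [← hupd τ hτ, signedMinor_update]
    rw [hupd τ hτ, h1, prod_detCoeff_image τ.2.1.injective (hmin τ), h2]

/-- Global linear functions annihilate `∑_σ (det Â_σ)^d / c_σ`. -/
theorem sum_mul_monomialDegree [M.Loopless] (hE : M.E = Set.univ)
    (hrank : M.eRank = ((k + 1 + 1 : ℕ) : ℕ∞)) {v : α → Fin k → ℝ} (hv : IsGeneralFamily M v)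
    {l : α → ℝ} (hl : ∑ i, l i = 0) {m : NontrivialFlat M →₀ ℕ} (hdeg : m.degree = k) :
    ∑ G : NontrivialFlat M, sumOverFlat l (G : Set α) *
      monomialDegree M v (m + Finsupp.single G 1) = 0 := by
  classical
  refine eq_zero_of_squarefree_of_linear (fun F : NontrivialFlat M => sumOverFlat v (F : Set α))
    (exists_dual_of_chain hrank hv) (Nat.le_succ k)
    (fun m => ∑ G : NontrivialFlat M, sumOverFlat l (G : Set α) *
      monomialDegree M v (m + Finsupp.single G 1)) ?_ ?_
    (fun m hm hc hs => sum_mul_monomialDegree_of_squarefree hE hrank hv hl hm hc hs) m hdeg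
  · intro m hm
    refine Finset.sum_eq_zero fun G _ => ?_
    rw [monomialDegree_of_not_isChain, mul_zero]
    refine fun h => hm (h.mono fun F hF => ?_)
    simp only [Finset.mem_coe, Finsupp.mem_support_iff, Finsupp.add_apply] at hF ⊢
    omega
  · intro y m _
    -- each single chain contributes zero, since `y ∘ v` annihilates `det Â_σ`
    simp only [monomialDegree_add_single, Finset.mul_sum]
    rw [Finset.sum_comm]
    refine Finset.sum_eq_zero fun G _ => ?_
    rw [Finset.sum_comm]
    refine Finset.sum_eq_zero fun σ _ => ?_
    rw [← mul_zero (sumOverFlat l (G : Set α) * ((∏ j, signedMinor M v σ.1 j)⁻¹ *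
      ((m.prod fun F n => detCoeff M v σ.1 F ^ n) * detCoeff M v σ.1 G))),
      ← sum_dotProduct_mul_detCoeff v σ.1 y, Finset.mul_sum]
    refine Finset.sum_congr rfl fun H _ => ?_
    rw [Finsupp.prod_add_index' (by simp) (fun _ _ _ => pow_add _ _ _),
      Finsupp.prod_single_index (by simp), pow_one]
    ring

end Degree

/-! ### The degree map -/

section DegreeMap

variable {α : Type*} [Fintype α] {M : Matroid α} {k : ℕ}

/-- The functional on `ℝ[∂_F]` which applies a differential operator to `∑_σ (det Â_σ)^d / c_σ`
and evaluates at zero; it is supported in degree `d = k + 1`. -/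
noncomputable def degreeFunctional (M : Matroid α) (v : α → Fin k → ℝ) :
    MvPolynomial (NontrivialFlat M) ℝ →ₗ[ℝ] ℝ :=
  (MvPolynomial.basisMonomials (NontrivialFlat M) ℝ).constr ℝ fun m =>
    if m.degree = k + 1 then monomialDegree M v m else 0

theorem degreeFunctional_monomial (v : α → Fin k → ℝ) (m : NontrivialFlat M →₀ ℕ) (c : ℝ) :
    degreeFunctional M v (MvPolynomial.monomial m c) =
      c * if m.degree = k + 1 then monomialDegree M v m else 0 := by
  have h : MvPolynomial.monomial m c =
      c • MvPolynomial.basisMonomials (NontrivialFlat M) ℝ m := by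
    simp [MvPolynomial.smul_monomial]
  rw [h, map_smul, degreeFunctional, Module.Basis.constr_basis, smul_eq_mul]

theorem prod_X_eq_monomial {L ι : Type*} (s : Finset ι) (f : ι → L) :
    (∏ j ∈ s, MvPolynomial.X (f j) : MvPolynomial L ℝ) =
      MvPolynomial.monomial (∑ j ∈ s, Finsupp.single (f j) 1) 1 := by
  rw [MvPolynomial.monomial_sum_one]
  rfl

theorem degreeFunctional_prod_X (v : α → Fin k → ℝ) (f : Fin (k + 1) → NontrivialFlat M) :
    degreeFunctional M v (∏ j, MvPolynomial.X (f j)) = ∑ σ : MaximalFlatChain M (k + 1),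
      (∏ j, signedMinor M v σ.1 j)⁻¹ * ∏ j, detCoeff M v σ.1 (f j) := by
  classical
  rw [prod_X_eq_monomial, degreeFunctional_monomial, one_mul, if_pos (by simp)]
  refine Finset.sum_congr rfl fun σ _ => ?_
  rw [← Finsupp.prod_finsetSum_index (by simp) (fun _ _ _ => pow_add _ _ _)]
  simp

theorem degreeFunctional_maximalFlatChain [M.Loopless]
    {v : α → Fin k → ℝ} (hv : IsGeneralFamily M v) (σ : MaximalFlatChain M (k + 1)) :
    degreeFunctional M v (∏ j, MvPolynomial.X (σ.1 j)) = 1 := by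
  classical
  rw [degreeFunctional_prod_X, Finset.sum_eq_single σ]
  · simp only [detCoeff_apply σ.2.1.injective]
    exact inv_mul_cancel₀ (Finset.prod_ne_zero_iff.2 fun j _ =>
      (chainConstant_ne_zero_iff σ.2.1.injective).1 (hv.2 σ) j)
  · intro τ _ hτ
    obtain ⟨j, hj⟩ : ∃ j, σ.1 j ∉ Set.range τ.1 := by
      by_contra! h
      refine hτ (Subtype.ext ?_)
      refine (Set.range_injOn_strictMono τ.2.1 σ.2.1 ?_)
      exact (σ.2.2.2 τ.2.2.isChain (Set.range_subset_iff.2 h)).symm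
    have h0 : ∏ i, detCoeff M v τ.1 (σ.1 i) = 0 :=
      Finset.prod_eq_zero (Finset.mem_univ j) (detCoeff_eq_zero hj)
    rw [h0, mul_zero]
  · simp

theorem mul_eq_zero_of_mem_span {σ : Type*} {s : Set (MvPolynomial σ ℝ)}
    (Φ : MvPolynomial σ ℝ →ₗ[ℝ] ℝ)
    (h : ∀ p ∈ s, ∀ m c, Φ (MvPolynomial.monomial m c * p) = 0)
    {p : MvPolynomial σ ℝ} (hp : p ∈ Ideal.span s) : Φ p = 0 := by
  have : ∀ q, Φ (q * p) = 0 := by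
    refine Submodule.span_induction (p := fun p _ => ∀ q, Φ (q * p) = 0) ?_ ?_ ?_ ?_ hp
    · intro p hp q
      induction q using MvPolynomial.induction_on' with
      | monomial m c => exact h p hp m c
      | add a b ha hb => rw [add_mul, map_add, ha, hb, add_zero]
    · intro q; rw [mul_zero, map_zero]
    · intro a b _ _ ha hb q; rw [mul_add, map_add, ha, hb, add_zero]
    · intro a b _ hb q; rw [smul_eq_mul, ← mul_assoc, hb]
  simpa using this 1

/-- The functional vanishes on the defining ideal of the Chow ring. -/
theorem degreeFunctional_eq_zero [M.Loopless] (hE : M.E = Set.univ)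
    (hrank : M.eRank = ((k + 1 + 1 : ℕ) : ℕ∞)) {v : α → Fin k → ℝ} (hv : IsGeneralFamily M v)
    {p : MvPolynomial (NontrivialFlat M) ℝ}
    (hp : p ∈ stanleyReisnerIdeal M ⊔ globalLinearIdeal M) : degreeFunctional M v p = 0 := by
  classical
  obtain ⟨a, ha, b, hb, rfl⟩ := Submodule.mem_sup.1 hp
  rw [map_add, mul_eq_zero_of_mem_span (degreeFunctional M v) ?_ ha,
    mul_eq_zero_of_mem_span (degreeFunctional M v) ?_ hb, add_zero]
  · rintro _ ⟨l, hl, rfl⟩ m c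
    rw [Finset.mul_sum, map_sum]
    have hterm : ∀ G : NontrivialFlat M, degreeFunctional M v (MvPolynomial.monomial m c *
        (MvPolynomial.C (sumOverFlat l (G : Set α)) * MvPolynomial.X G)) =
        if m.degree = k then c * (sumOverFlat l (G : Set α) *
          monomialDegree M v (m + Finsupp.single G 1)) else 0 := by
      intro G
      rw [MvPolynomial.C_mul_X_eq_monomial, MvPolynomial.monomial_mul, degreeFunctional_monomial]
      simp [mul_assoc]
    simp only [hterm]
    split_ifs with h
    · rw [← Finset.mul_sum, sum_mul_monomialDegree hE hrank hv hl h, mul_zero]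
    · simp
  · rintro _ ⟨S, hS, rfl⟩ m c
    rw [prod_X_eq_monomial S fun F => F, MvPolynomial.monomial_mul, degreeFunctional_monomial,
      monomialDegree_of_not_isChain, ite_self, mul_zero]
    refine fun h => hS (h.mono fun F hF => ?_)
    simp only [Finset.mem_coe, Finsupp.mem_support_iff, Finsupp.add_apply,
      Finsupp.finsetSum_apply, Finsupp.single_apply] at hF ⊢
    simp [hF]

theorem exists_isDegreeMap [M.Loopless] (hE : M.E = Set.univ)
    (hrank : M.eRank = ((k + 1 + 1 : ℕ) : ℕ∞)) {v : α → Fin k → ℝ} (hv : IsGeneralFamily M v) :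
    ∃ φ : chowPart M (k + 1) →ₗ[ℝ] ℝ, IsDegreeMap M (k + 1) φ ∧
      ∀ f, φ (chowMonomial M f) = degreeFunctional M v (∏ j, MvPolynomial.X (f j)) := by
  set I := stanleyReisnerIdeal M ⊔ globalLinearIdeal M
  obtain ⟨s, hs⟩ := (Ideal.Quotient.mkₐ ℝ I).toLinearMap.exists_rightInverse_of_surjective
    (LinearMap.range_eq_top.2 (Ideal.Quotient.mkₐ_surjective ℝ I))
  have hg : ∀ p, degreeFunctional M v (s (Ideal.Quotient.mk I p)) = degreeFunctional M v p := by
    intro p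
    rw [← sub_eq_zero, ← map_sub]
    refine degreeFunctional_eq_zero hE hrank hv (Ideal.Quotient.eq.1 ?_)
    exact LinearMap.congr_fun hs (Ideal.Quotient.mk I p)
  have hφ : ∀ f, ((degreeFunctional M v ∘ₗ s) ∘ₗ (chowPart M (k + 1)).subtype)
      (chowMonomial M f) = degreeFunctional M v (∏ j, MvPolynomial.X (f j)) := by
    intro f
    rw [← hg, map_prod]
    rfl
  exact ⟨_, fun σ => by rw [hφ, degreeFunctional_maximalFlatChain hv], hφ⟩

/-- A functional on `CH^d(M)` is determined by its values on the maximal chains, because modulo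
the linear forms that factor through a general family every monomial is a combination of these. -/
theorem eq_zero_of_chowMonomial_eq_zero [M.Loopless]
    (hrank : M.eRank = ((k + 1 + 1 : ℕ) : ℕ∞)) {v : α → Fin k → ℝ} (hv : IsGeneralFamily M v)
    (δ : chowPart M (k + 1) →ₗ[ℝ] ℝ)
    (hδ : ∀ σ : MaximalFlatChain M (k + 1), δ (chowMonomial M σ.1) = 0) : δ = 0 := by
  classical
  obtain ⟨g, hg⟩ := LinearMap.exists_extend δ
  set I := stanleyReisnerIdeal M ⊔ globalLinearIdeal M
  have hgI : ∀ p ∈ I, g (Ideal.Quotient.mk I p) = 0 := fun p hp => by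
    rw [Ideal.Quotient.eq_zero_iff_mem.2 hp, map_zero]
  have hmon : ∀ m : NontrivialFlat M →₀ ℕ, m.degree = k + 1 →
      g (Ideal.Quotient.mk I (MvPolynomial.monomial m 1)) = 0 := by
    refine eq_zero_of_squarefree_of_linear
      (fun F : NontrivialFlat M => sumOverFlat v (F : Set α))
      (exists_dual_of_chain hrank hv) le_rfl
      (fun m => g (Ideal.Quotient.mk I (MvPolynomial.monomial m 1))) ?_ ?_ ?_
    · intro m hm
      refine hgI _ (Ideal.mem_sup_left ?_)
      have hle : ∑ F ∈ m.support, Finsupp.single F 1 ≤ m := by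
        intro F
        simp only [Finsupp.finsetSum_apply, Finsupp.single_apply, Finset.sum_ite_eq',
          Finsupp.mem_support_iff]
        split_ifs with h <;> omega
      rw [← tsub_add_cancel_of_le hle, ← one_mul (1 : ℝ), ← MvPolynomial.monomial_mul,
        ← prod_X_eq_monomial m.support fun F => F]
      exact Ideal.mul_mem_left _ _ (Ideal.subset_span ⟨m.support, hm, rfl⟩)
    · intro y m _
      have hmem : (∑ G : NontrivialFlat M, MvPolynomial.C (y ⬝ᵥ sumOverFlat v (G : Set α)) *
          MvPolynomial.X G) * MvPolynomial.monomial m 1 ∈ I := by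
        refine Ideal.mul_mem_right _ _ (Ideal.mem_sup_right (Ideal.subset_span
          ⟨fun i => y ⬝ᵥ v i, ?_, ?_⟩))
        · rw [← dotProduct_sum, hv.1, dotProduct_zero]
        · simp only [dotProduct_sumOverFlat]
      have h0 := hgI _ hmem
      rw [Finset.sum_mul, map_sum, map_sum] at h0
      rw [← h0]
      refine Finset.sum_congr rfl fun G _ => ?_
      rw [MvPolynomial.C_mul_X_eq_monomial, MvPolynomial.monomial_mul, mul_one, add_comm,
        ← smul_eq_mul, ← map_smul]
      congr 1
      rw [← Ideal.Quotient.mkₐ_eq_mk ℝ, ← map_smul, MvPolynomial.smul_monomial, smul_eq_mul,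
        mul_one]
    · intro m hdeg hchain hsq
      obtain ⟨σ, hσ⟩ := exists_maximalFlatChain hrank hchain
      have hsupp : m.support = Finset.univ.image σ.1 := by
        refine Finset.eq_of_subset_of_card_le (fun G hG => ?_) ?_
        · obtain ⟨i, rfl⟩ := hσ hG
          exact Finset.mem_image_of_mem _ (Finset.mem_univ _)
        · rw [Finset.card_image_of_injective _ σ.2.1.injective, card_support_of_le_one hsq, hdeg]
          simp
      have hm : m = ∑ j, Finsupp.single (σ.1 j) 1 := by
        rw [← Finset.sum_image (f := fun F => Finsupp.single F 1) σ.2.1.injective.injOn, ← hsupp]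
        ext F
        simp only [Finsupp.finsetSum_apply, Finsupp.single_apply, Finset.sum_ite_eq',
          Finsupp.mem_support_iff]
        have := hsq F
        split_ifs with h <;> omega
      rw [hm, ← prod_X_eq_monomial, map_prod]
      exact (LinearMap.congr_fun hg (chowMonomial M σ.1)).trans (hδ σ)
  ext ⟨x, hx⟩
  obtain ⟨p, hp, rfl⟩ := hx
  rw [← hg]
  change g (Ideal.Quotient.mkₐ ℝ I p) = 0
  rw [p.as_sum, map_sum, map_sum]
  refine Finset.sum_eq_zero fun m hm => ?_
  have h1 : MvPolynomial.monomial m (p.coeff m) =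
      p.coeff m • (MvPolynomial.monomial m 1 : MvPolynomial (NontrivialFlat M) ℝ) := by
    rw [MvPolynomial.smul_monomial, smul_eq_mul, mul_one]
  have hdeg : m.degree = k + 1 := by
    rw [Finsupp.degree_eq_weight_one]
    exact hp (MvPolynomial.mem_support_iff.1 hm)
  rw [h1, map_smul, map_smul, Ideal.Quotient.mkₐ_eq_mk, hmon m hdeg, smul_zero]

theorem degreeMap_chowMonomial [M.Loopless] (hE : M.E = Set.univ)
    (hrank : M.eRank = ((k + 1 + 1 : ℕ) : ℕ∞)) {v : α → Fin k → ℝ} (hv : IsGeneralFamily M v)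
    (f : Fin (k + 1) → NontrivialFlat M) :
    degreeMap M (k + 1) (chowMonomial M f) =
      degreeFunctional M v (∏ j, MvPolynomial.X (f j)) := by
  obtain ⟨φ, hφ, hφf⟩ := exists_isDegreeMap hE hrank hv
  have hex : ∃ φ, IsDegreeMap M (k + 1) φ := ⟨φ, hφ⟩
  have hdeg : IsDegreeMap M (k + 1) (degreeMap M (k + 1)) := by
    rw [degreeMap, dif_pos hex]
    exact hex.choose_spec
  have := eq_zero_of_chowMonomial_eq_zero hrank hv (degreeMap M (k + 1) - φ) fun σ => by
    rw [LinearMap.sub_apply, hdeg σ, hφ σ, sub_self]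
  rw [sub_eq_zero.1 this, hφf]

end DegreeMap

/-- Here `M` is a loopless matroid of rank `d + 1` on a finite set, with `d = k + 1 ≥ 1`. -/
theorem mainTheorem1 {α : Type*} [Fintype α] (M : Matroid α) [M.Loopless]
    (hE : M.E = Set.univ) (k : ℕ) (hrank : M.eRank = ((k + 1 + 1 : ℕ) : ℕ∞)) :
    (∃! φ : chowPart M (k + 1) →ₗ[ℝ] ℝ, IsDegreeMap M (k + 1) φ) ∧
    (∃ v : α → Fin k → ℝ, IsGeneralFamily M v) ∧
    ∀ v : α → Fin k → ℝ, IsGeneralFamily M v →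
      mixedVolume M (k + 1) =
        ∑ σ : MaximalFlatChain M (k + 1),
          MvPolynomial.C ((chainConstant M v σ.1)⁻¹) *
            (augmentedMatrix M v σ.1).det ^ (k + 1) := by
  classical
  obtain ⟨v₀, hv₀⟩ := exists_isGeneralFamily hE hrank
  refine ⟨?_, ⟨v₀, hv₀⟩, fun v hv => ?_⟩
  · obtain ⟨φ, hφ, _⟩ := exists_isDegreeMap hE hrank hv₀
    refine ⟨φ, hφ, fun φ' hφ' => sub_eq_zero.1 ?_⟩
    refine eq_zero_of_chowMonomial_eq_zero hrank hv₀ _ fun σ => ?_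
    rw [LinearMap.sub_apply, hφ σ, hφ' σ, sub_self]
  · have hpow : ∀ σ : MaximalFlatChain M (k + 1), (augmentedMatrix M v σ.1).det ^ (k + 1) =
        ∑ f : Fin (k + 1) → NontrivialFlat M,
          MvPolynomial.C (∏ j, detCoeff M v σ.1 (f j)) * ∏ j, MvPolynomial.X (f j) := by
      intro σ
      rw [det_augmentedMatrix_eq_sum_detCoeff, Finset.sum_pow', Fintype.piFinset_univ]
      refine Finset.sum_congr rfl fun f _ => ?_
      rw [Finset.prod_mul_distrib, map_prod]
    have hconst : ∀ σ : MaximalFlatChain M (k + 1), chainConstant M v σ.1 =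
        ((k + 1).factorial : ℝ) * ∏ j, signedMinor M v σ.1 j := by
      intro σ
      simp only [← detCoeff_apply σ.2.1.injective]
      rfl
    simp only [mixedVolume, degreeMap_chowMonomial hE hrank hv, degreeFunctional_prod_X, hpow,
      hconst, mul_inv, map_mul, map_sum, Finset.mul_sum, Finset.sum_mul]
    rw [Finset.sum_comm]
    refine Finset.sum_congr rfl fun σ _ => Finset.sum_congr rfl fun f _ => ?_
    ring
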